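/- **Definitions.** Let $k\in\mathbb N$. A $k$-graph $(\Lambda,d)$ is a countable category $\Lambda$, with range and source maps $r,s$ (the product $\lambda\mu$ of paths is defined when $s(\lambda)=r(\mu)$), together with a functor $d:\Lambda\to\mathbb N^k$ such that whenever $d(\lambda)=m+n$ there are unique $\mu,\nu\in\Lambda$ with $\lambda=\mu\nu$, $d(\mu)=m$, $d(\nu)=n$. Vertices (objects) are identified with the paths of degree $0$; $\Lambda^0$ is the set of vertices. For $v\in\Lambda^0$ and $m\in\mathbb N^k$ put $\Lambda^m(v)=\{\lambda: d(\lambda)=m,\ r(\lambda)=v\}$ and $$\Lambda^{\le m}(v)=\{\lambda: r(\lambda)=v,\ d(\lambda)\le m,\ \text{and } \Lambda^{e_i}(s(\lambda))=\emptyset \text{ for every } i \text{ with } d(\lambda)+e_i\le m\},$$ where $e_1,\dots,e_k$ is the standard basis of $\mathbb N^k$. $\Lambda$ is *row-finite* if all sets $\Lambda^m(v)$ are finite, and *locally convex* if for all $v\in\Lambda^0$, $i\ne j$, $\lambda\in\Lambda^{e_i}(v)$ and $\mu\in\Lambda^{e_j}(v)$, both $\Lambda^{e_j}(s(\lambda))$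 and $\Lambda^{e_i}(s(\mu))$ are nonempty. For row-finite $\Lambda$, a *Cuntz–Krieger $\Lambda$-family* in a $C^*$-algebra $B$ is a family of partial isometries $\{t_\lambda:\lambda\in\Lambda\}\subset B$ such that 1. $\{t_v:v\in\Lambda^0\}$ are mutually orthogonal projections; 2. $t_{\lambda\mu}=t_\lambda t_\mu$ whenever $s(\lambda)=r(\mu)$; 3. $t_\lambda^*t_\lambda=t_{s(\lambda)}$ for all $\lambda$; 4. $t_v=\sum_{\lambda\in\Lambda^{\le m}(v)}t_\lambda t_\lambda^*$ for all $v\in\Lambda^0$ and $m\in\mathbb N^k$. $C^*(\{t_\lambda\})$ is the $C^*$-subalgebra of $B$ generated by the family. $C^*(\Lambda)$ is the $C^*$-algebra generated by a universal Cuntz–Krieger $\Lambda$-family $\{s_\lambda\}$: for every Cuntz–Krieger $\Lambda$-family $\{t_\lambda\}$ there is a unique $*$-homomorphism $\pi:C^*(\Lambda)\to C^*(\{t_\lambda\})$ with $\pi(s_\lambda)=t_\lambda$ for all $\lambda$. The *gauge action* $\gamma$ of $\mathbb T^k$ on $C^*(\Lambda)$ is the action by automorphisms determined by $\gamma_z(s_\lambda)=z^{d(\lambda)}s_\lambda$,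 where $z^n=z_1^{n_1}\cdots z_k^{n_k}$. **Theorem 4.1 (Gauge-Invariant Uniqueness Theorem).** Let $(\Lambda,d)$ be a locally convex row-finite $k$-graph, let $\{t_\lambda:\lambda\in\Lambda\}$ be a Cuntz–Krieger $\Lambda$-family in a $C^*$-algebra, and let $\pi:C^*(\Lambda)\to C^*(\{t_\lambda\})$ be the $*$-homomorphism with $\pi(s_\lambda)=t_\lambda$ for all $\lambda$. Suppose that $t_v\ne0$ for every $v\in\Lambda^0$ and that there is a strongly continuous action $\beta:\mathbb T^k\to\operatorname{Aut}(C^*(\{t_\lambda:\lambda\in\Lambda\}))$ (that is, a group homomorphism such that $z\mapsto\beta_z(b)$ is norm continuous for each $b$) with $\beta_z\circ\pi=\pi\circ\gamma_z$ for all $z\in\mathbb T^k$. Then $\pi$ is faithful (injective). -/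

import Mathlib

open CategoryTheory
open scoped ENNReal

universe u v w

set_option linter.checkUnivs false

/-! ### Higher-rank graphs -/

/-- A graph of rank `k`: a countable category with a degree functor to the monoid `ℕ^k` that
satisfies the factorisation property. A path `f : x ⟶ y` has source `x` and range `y`, so that the
product of paths `f g` (defined when the source of `f` is the range of `g`) is `g ≫ f`. -/
structure KGraph (k : ℕ) where
  /-- the vertices -/
  Obj : Type u
  [category : Category.{v} Obj]
  [countable_obj : Countable Obj]
  [countable_hom : ∀ x y : Obj, Countable (x ⟶ y)]
  /-- the degree map -/
  deg : ∀ {x y : Obj}, (x ⟶ y) → (Fin k → ℕ)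
  deg_id : ∀ x : Obj, deg (𝟙 x) = 0
  deg_comp : ∀ {x y z : Obj} (g : x ⟶ y) (f : y ⟶ z), deg (g ≫ f) = deg f + deg g
  /-- Every path of degree `m + n` is `μ ν` for unique composable `μ`, `ν` of degrees `m`, `n`. -/
  factorisation : ∀ {x z : Obj} (f : x ⟶ z) (m n : Fin k → ℕ), deg f = m + n →
    ∃! p : Σ y : Obj, (x ⟶ y) × (y ⟶ z),
      p.2.1 ≫ p.2.2 = f ∧ deg p.2.2 = m ∧ deg p.2.1 = n

namespace KGraph

variable {k : ℕ}

instance (Λ : KGraph.{u, v} k) : Category.{v} Λ.Obj := Λ.category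

/-- The standard basis vector `e_i` of `ℕ^k`. -/
def e (i : Fin k) : Fin k → ℕ := Pi.single i 1

/-- The paths with range `y`: pairs of a source and a path from it to `y`. -/
abbrev PathTo (Λ : KGraph.{u, v} k) (y : Λ.Obj) : Type (max u v) := Σ x : Λ.Obj, (x ⟶ y)

/-- The set of the paths of degree `n` with range `y`. -/
def pathsOfDeg (Λ : KGraph.{u, v} k) (n : Fin k → ℕ) (y : Λ.Obj) : Set (Λ.PathTo y) :=
  {p | Λ.deg p.2 = n}

/-- The set `Λ^{≤ q}(y)` of the paths `p` with range `y` and degree at most `q` such that no edge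
of degree `e_i` has range `s(p)` whenever `d(p) + e_i ≤ q`. -/
def pathsLE (Λ : KGraph.{u, v} k) (q : Fin k → ℕ) (y : Λ.Obj) : Set (Λ.PathTo y) :=
  {p | Λ.deg p.2 ≤ q ∧ ∀ i : Fin k, Λ.deg p.2 + e i ≤ q → Λ.pathsOfDeg (e i) p.1 = ∅}

/-- `Λ` is row-finite if every vertex is the range of finitely many paths of each degree. -/
class RowFinite (Λ : KGraph.{u, v} k) : Prop where
  finite_pathsOfDeg : ∀ (n : Fin k → ℕ) (y : Λ.Obj), (Λ.pathsOfDeg n y).Finite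

/-- `Λ` is locally convex if, for `i ≠ j`, whenever `f` and `g` are edges of degrees `e_i` and
`e_j` with the same range, there are edges of degree `e_j` with range `s(f)` and edges of degree
`e_i` with range `s(g)`. -/
def LocallyConvex (Λ : KGraph.{u, v} k) : Prop :=
  ∀ (y : Λ.Obj) (i j : Fin k), i ≠ j →
    ∀ f ∈ Λ.pathsOfDeg (e i) y, ∀ g ∈ Λ.pathsOfDeg (e j) y,
      (Λ.pathsOfDeg (e j) f.1).Nonempty ∧ (Λ.pathsOfDeg (e i) g.1).Nonempty

theorem finite_pathsLE (Λ : KGraph.{u, v} k) [Λ.RowFinite] (q : Fin k → ℕ) (y : Λ.Obj) :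
    (Λ.pathsLE q y).Finite := by
  refine ((Set.finite_Iic q).biUnion
    (fun n _ => RowFinite.finite_pathsOfDeg (Λ := Λ) n y)).subset ?_
  intro p hp
  exact Set.mem_biUnion (x := Λ.deg p.2) hp.1 rfl

/-! ### Cuntz-Krieger families -/

/-- A family of elements `t f` of `B` indexed by all the paths `f` of `Λ`. -/
abbrev Family (Λ : KGraph.{u, v} k) (B : Type w) : Type (max u v w) :=
  ∀ ⦃x y : Λ.Obj⦄, (x ⟶ y) → B

/-- The Cuntz-Krieger relations for a family of partial isometries in a C*-algebra `B`. The
vertex `x` is identified with the path `𝟙 x` of degree `0`. -/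
structure IsCuntzKrieger (Λ : KGraph.{u, v} k) [Λ.RowFinite] {B : Type w}
    [NonUnitalCStarAlgebra B] (t : Λ.Family B) : Prop where
  partialIsometry : ∀ ⦃x y : Λ.Obj⦄ (f : x ⟶ y), t f * star (t f) * t f = t f
  projection : ∀ x : Λ.Obj, IsStarProjection (t (𝟙 x))
  orthogonal : ∀ x y : Λ.Obj, x ≠ y → t (𝟙 x) * t (𝟙 y) = 0
  comp : ∀ ⦃x y z : Λ.Obj⦄ (f : y ⟶ z) (g : x ⟶ y), t (g ≫ f) = t f * t g
  star_mul_self : ∀ ⦃x y : Λ.Obj⦄ (f : x ⟶ y), star (t f) * t f = t (𝟙 x)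
  sum_eq : ∀ (y : Λ.Obj) (m : Fin k → ℕ),
    t (𝟙 y) = ∑ p ∈ (Λ.finite_pathsLE m y).toFinset, t p.2 * star (t p.2)

/-- The C*-subalgebra of `B` generated by a family. -/
noncomputable def generated (Λ : KGraph.{u, v} k) {B : Type w} [NonUnitalCStarAlgebra B]
    (t : Λ.Family B) : NonUnitalStarSubalgebra ℂ B :=
  (NonUnitalStarAlgebra.adjoin ℂ {b | ∃ (x y : Λ.Obj) (f : x ⟶ y), t f = b}).topologicalClosure

theorem continuous_hom {A D : Type*} [NonUnitalCStarAlgebra A] [NonUnitalCStarAlgebra D]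
    (φ : A →⋆ₙₐ[ℂ] D) : Continuous φ :=
  NonUnitalStarAlgHom.instContinuousLinearMapClassComplex.map_continuous φ

section Generated

variable (Λ : KGraph.{u, v} k) {B : Type w} [NonUnitalCStarAlgebra B]

instance (t : Λ.Family B) : IsClosed (Λ.generated t : Set B) :=
  NonUnitalStarSubalgebra.isClosed_topologicalClosure _

theorem mem_generated (t : Λ.Family B) {x y : Λ.Obj} (f : x ⟶ y) : t f ∈ Λ.generated t :=
  NonUnitalStarSubalgebra.le_topologicalClosure _
    (NonUnitalStarAlgebra.subset_adjoin ℂ _ ⟨x, y, f, rfl⟩)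

noncomputable instance (t : Λ.Family B) : NonUnitalCStarAlgebra (Λ.generated t) :=
  NonUnitalStarSubalgebra.nonUnitalCStarAlgebra _

theorem generated_le (t : Λ.Family B) (S : NonUnitalStarSubalgebra ℂ B)
    (hS : IsClosed (S : Set B)) (h : ∀ ⦃x y : Λ.Obj⦄ (f : x ⟶ y), t f ∈ S) :
    Λ.generated t ≤ S := by
  refine NonUnitalStarSubalgebra.topologicalClosure_minimal _ ?_ hS
  refine NonUnitalStarAlgebra.adjoin_le ?_
  rintro _ ⟨x, y, f, rfl⟩
  exact h f

/-- Two homomorphisms on the C*-algebra generated by a family agree if they agree on the family. -/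
theorem generated_hom_ext (t : Λ.Family B) {D : Type*} [NonUnitalCStarAlgebra D]
    (φ ψ : Λ.generated t →⋆ₙₐ[ℂ] D)
    (h : ∀ ⦃x y : Λ.Obj⦄ (f : x ⟶ y),
      φ ⟨t f, Λ.mem_generated t f⟩ = ψ ⟨t f, Λ.mem_generated t f⟩) : φ = ψ := by
  have hφ : Continuous φ := continuous_hom φ
  have hψ : Continuous ψ := continuous_hom ψ
  let E : NonUnitalStarSubalgebra ℂ (Λ.generated t) := NonUnitalStarAlgHom.equalizer φ ψ
  have hE : IsClosed (E : Set (Λ.generated t)) := isClosed_eq hφ hψ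
  have hcl : IsClosed ((E.map (NonUnitalStarSubalgebraClass.subtype (Λ.generated t)) :
      NonUnitalStarSubalgebra ℂ B) : Set B) := by
    have h0 : IsClosed (Λ.generated t : Set B) := inferInstance
    have := h0.isClosedEmbedding_subtypeVal.isClosedMap _ hE
    exact this
  have hle := Λ.generated_le t _ hcl (fun x y f => ⟨⟨t f, Λ.mem_generated t f⟩, h f, rfl⟩)
  ext a
  obtain ⟨b, hb, hba⟩ := hle a.2
  have : b = a := Subtype.ext hba
  subst this
  exact hb

end Generated

theorem IsCuntzKrieger.norm_le_one {Λ : KGraph.{u, v} k} [Λ.RowFinite] {B : Type w}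
    [NonUnitalCStarAlgebra B] {t : Λ.Family B} (ht : Λ.IsCuntzKrieger t) {x y : Λ.Obj}
    (f : x ⟶ y) : ‖t f‖ ≤ 1 := by
  have h1 : ‖t (𝟙 x)‖ * ‖t (𝟙 x)‖ = ‖t (𝟙 x)‖ := by
    rw [← CStarRing.norm_star_mul_self, (ht.projection x).isSelfAdjoint.star_eq,
      (ht.projection x).isIdempotentElem.eq]
  have h2 : ‖t f‖ * ‖t f‖ = ‖t (𝟙 x)‖ := by
    rw [← CStarRing.norm_star_mul_self, ht.star_mul_self]
  have h3 : ‖t (𝟙 x)‖ ≤ 1 := by nlinarith [norm_nonneg (t (𝟙 x))]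
  nlinarith [norm_nonneg (t f)]

/-- The number `z^n = z_1^{n_1} ⋯ z_k^{n_k}`. -/
noncomputable def torusPow (z : Fin k → Circle) (n : Fin k → ℕ) : Circle := ∏ i, z i ^ n i

theorem torusPow_add (z : Fin k → Circle) (m n : Fin k → ℕ) :
    torusPow z (m + n) = torusPow z m * torusPow z n := by
  simp [torusPow, pow_add, Finset.prod_mul_distrib]

theorem torusPow_zero (z : Fin k → Circle) : torusPow z 0 = 1 := by simp [torusPow]

theorem torusPow_one (n : Fin k → ℕ) : torusPow (1 : Fin k → Circle) n = 1 := by simp [torusPow]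

theorem torusPow_mul (z z' : Fin k → Circle) (n : Fin k → ℕ) :
    torusPow (z * z') n = torusPow z n * torusPow z' n := by
  simp [torusPow, mul_pow, Finset.prod_mul_distrib]

/-- The rescaled family `z^{d(f)} t_f`. -/
noncomputable def twist (Λ : KGraph.{u, v} k) {B : Type w} [NonUnitalCStarAlgebra B]
    (z : Fin k → Circle) (t : Λ.Family B) : Λ.Family B :=
  fun _ _ f => (torusPow z (Λ.deg f) : ℂ) • t f

theorem circle_conj_mul (c : Circle) : star (c : ℂ) * (c : ℂ) = 1 := by
  have := Complex.normSq_eq_conj_mul_self (z := (c : ℂ))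
  rw [Circle.normSq_coe] at this
  simpa using this.symm

theorem IsCuntzKrieger.twist {Λ : KGraph.{u, v} k} [Λ.RowFinite] {B : Type w}
    [NonUnitalCStarAlgebra B] {t : Λ.Family B} (ht : Λ.IsCuntzKrieger t) (z : Fin k → Circle) :
    Λ.IsCuntzKrieger (Λ.twist z t) := by
  have hid : ∀ x : Λ.Obj, Λ.twist z t (𝟙 x) = t (𝟙 x) := fun x => by
    simp [KGraph.twist, Λ.deg_id, torusPow_zero]
  have hr : ∀ {x y : Λ.Obj} (f : x ⟶ y),
      Λ.twist z t f * star (Λ.twist z t f) = t f * star (t f) := fun f => by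
    simp only [KGraph.twist, star_smul, smul_mul_smul_comm]
    rw [mul_comm, circle_conj_mul, one_smul]
  refine ⟨fun x y f => ?_, fun x => ?_, fun x y hxy => ?_, fun x y z f g => ?_, fun x y f => ?_,
    fun y m => ?_⟩
  · rw [hr]
    simp only [KGraph.twist, mul_smul_comm, ht.partialIsometry]
  · rw [hid]; exact ht.projection x
  · rw [hid, hid]; exact ht.orthogonal x y hxy
  · simp only [KGraph.twist, Λ.deg_comp, torusPow_add, ht.comp, Circle.coe_mul,
      smul_mul_smul_comm]
  · rw [hid, ← ht.star_mul_self f]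
    simp only [KGraph.twist, star_smul, smul_mul_smul_comm]
    rw [circle_conj_mul, one_smul]
  · rw [hid, ht.sum_eq y m]
    exact Finset.sum_congr rfl fun p _ => (hr p.2).symm

/-! ### The universal C*-algebra

`C*(Λ)` is realised as the C*-algebra generated, in the `ℓ^∞`-product of all C*-algebras (in a
universe) with a Cuntz-Krieger `Λ`-family, by the family of the tuples `(t f)_t`. The theorems
below check that these tuples form a Cuntz-Krieger `Λ`-family, and that this family is universal. -/

/-- A C*-algebra together with a Cuntz-Krieger `Λ`-family in it. -/
structure CKPair (Λ : KGraph.{u, v} k) [Λ.RowFinite] where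
  /-- the C*-algebra -/
  Alg : Type w
  [cstar : NonUnitalCStarAlgebra Alg]
  /-- the Cuntz-Krieger family -/
  fam : Λ.Family Alg
  isCuntzKrieger : Λ.IsCuntzKrieger fam

instance (Λ : KGraph.{u, v} k) [Λ.RowFinite] (i : CKPair.{u, v, w} Λ) :
    NonUnitalCStarAlgebra i.Alg := i.cstar

section Universal

variable (Λ : KGraph.{u, v} k) [Λ.RowFinite]

/-- The `ℓ^∞`-product of the C*-algebras with a Cuntz-Krieger `Λ`-family. -/
abbrev BigProduct : Type (max u v (w + 1)) :=
  lp (fun i : CKPair.{u, v, w} Λ => i.Alg) ∞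

noncomputable instance : NonUnitalCStarAlgebra (BigProduct.{u, v, w} Λ) :=
  instNonUnitalCStarAlgebraSubtypePreLpMemAddSubgroupLpTopENNReal

/-- The tuples `(t f)_t` of the members of all Cuntz-Krieger families. -/
noncomputable def bigFamily : Λ.Family (BigProduct.{u, v, w} Λ) := fun _ _ f =>
  ⟨fun i => i.fam f, memℓp_infty ⟨1, by
    rintro _ ⟨i, rfl⟩
    exact i.isCuntzKrieger.norm_le_one f⟩⟩

/-- The universal C*-algebra `C*(Λ)`. -/
def CStar : Type (max u v (w + 1)) := Λ.generated (bigFamily.{u, v, w} Λ)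

noncomputable instance : NonUnitalCStarAlgebra (CStar.{u, v, w} Λ) :=
  inferInstanceAs (NonUnitalCStarAlgebra (Λ.generated (bigFamily.{u, v, w} Λ)))

/-- The inclusion of `C*(Λ)` in the product. -/
noncomputable def incl : CStar.{u, v, w} Λ →⋆ₙₐ[ℂ] BigProduct.{u, v, w} Λ :=
  NonUnitalStarSubalgebraClass.subtype (Λ.generated (bigFamily.{u, v, w} Λ))

theorem incl_injective : Function.Injective (incl.{u, v, w} Λ) := Subtype.val_injective

theorem incl_mem (a : CStar.{u, v, w} Λ) : incl Λ a ∈ Λ.generated (bigFamily.{u, v, w} Λ) := a.2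

/-- A homomorphism to the product with values in the subalgebra, as a homomorphism to `C*(Λ)`. -/
noncomputable def restr {D : Type*} [NonUnitalCStarAlgebra D]
    (φ : D →⋆ₙₐ[ℂ] BigProduct.{u, v, w} Λ)
    (h : ∀ a, φ a ∈ Λ.generated (bigFamily.{u, v, w} Λ)) : D →⋆ₙₐ[ℂ] CStar.{u, v, w} Λ :=
  NonUnitalStarAlgHom.codRestrict φ (Λ.generated (bigFamily.{u, v, w} Λ)) h

theorem incl_restr {D : Type*} [NonUnitalCStarAlgebra D]
    (φ : D →⋆ₙₐ[ℂ] BigProduct.{u, v, w} Λ)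
    (h : ∀ a, φ a ∈ Λ.generated (bigFamily.{u, v, w} Λ)) (a : D) :
    incl Λ (restr Λ φ h a) = φ a := rfl

/-- The universal Cuntz-Krieger family `{s_f}` in `C*(Λ)`. -/
noncomputable def s : Λ.Family (CStar.{u, v, w} Λ) := fun _ _ f =>
  ⟨bigFamily.{u, v, w} Λ f, Λ.mem_generated _ f⟩

theorem incl_s {x y : Λ.Obj} (f : x ⟶ y) :
    incl Λ (Λ.s f : CStar.{u, v, w} Λ) = bigFamily.{u, v, w} Λ f := rfl

theorem isCuntzKrieger_bigFamily : Λ.IsCuntzKrieger (bigFamily.{u, v, w} Λ) := by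
  refine ⟨fun x y f => ?_, fun x => ⟨?_, ?_⟩, fun x y hxy => ?_, fun x y z f g => ?_,
    fun x y f => ?_, fun y m => ?_⟩
  · exact lp.ext (funext fun i => i.isCuntzKrieger.partialIsometry f)
  · exact lp.ext (funext fun i => (i.isCuntzKrieger.projection x).isIdempotentElem)
  · exact lp.ext (funext fun i => (i.isCuntzKrieger.projection x).isSelfAdjoint)
  · exact lp.ext (funext fun i => i.isCuntzKrieger.orthogonal x y hxy)
  · exact lp.ext (funext fun i => i.isCuntzKrieger.comp f g)
  · exact lp.ext (funext fun i => i.isCuntzKrieger.star_mul_self f)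
  · refine lp.ext (funext fun i => ?_)
    rw [lp.coeFn_sum, Finset.sum_apply]
    exact i.isCuntzKrieger.sum_eq y m

/-- The generators of `C*(Λ)` form a Cuntz-Krieger family. -/
theorem isCuntzKrieger_s : Λ.IsCuntzKrieger (Λ.s : Λ.Family (CStar.{u, v, w} Λ)) := by
  have h := isCuntzKrieger_bigFamily.{u, v, w} Λ
  have hi := incl_injective.{u, v, w} Λ
  refine ⟨fun x y f => hi ?_, fun x => ⟨hi ?_, hi ?_⟩, fun x y hxy => hi ?_,
    fun x y z f g => hi ?_, fun x y f => hi ?_, fun y m => hi ?_⟩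
  · simpa only [map_mul, map_star, incl_s] using h.partialIsometry f
  · simpa only [map_mul, incl_s] using (h.projection x).isIdempotentElem.eq
  · simpa only [map_star, incl_s] using (h.projection x).isSelfAdjoint.star_eq
  · simpa only [map_mul, map_zero, incl_s] using h.orthogonal x y hxy
  · simpa only [map_mul, incl_s] using h.comp f g
  · simpa only [map_mul, map_star, incl_s] using h.star_mul_self f
  · simpa only [map_sum, map_mul, map_star, incl_s] using h.sum_eq y m

variable {Λ}

/-- A homomorphism on `C*(Λ)` is determined by its values on the generators. -/
theorem hom_ext {D : Type*} [NonUnitalCStarAlgebra D] (φ ψ : CStar.{u, v, w} Λ →⋆ₙₐ[ℂ] D)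
    (h : ∀ ⦃x y : Λ.Obj⦄ (f : x ⟶ y), φ (Λ.s f) = ψ (Λ.s f)) : φ = ψ :=
  Λ.generated_hom_ext _ φ ψ h

/-- Evaluation of a tuple at one Cuntz-Krieger family. -/
noncomputable def evalHom (i : CKPair.{u, v, w} Λ) : BigProduct.{u, v, w} Λ →⋆ₙₐ[ℂ] i.Alg where
  toFun a := a i
  map_smul' _ _ := rfl
  map_zero' := rfl
  map_add' _ _ := rfl
  map_mul' _ _ := rfl
  map_star' _ := rfl

/-- The universal property: every Cuntz-Krieger family `t` is the image of the generators of
`C*(Λ)` under a unique homomorphism to the C*-algebra generated by `t`. -/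
theorem existsUnique_hom {B : Type w} [NonUnitalCStarAlgebra B] {t : Λ.Family B}
    (ht : Λ.IsCuntzKrieger t) :
    ∃! π : CStar.{u, v, w} Λ →⋆ₙₐ[ℂ] Λ.generated t,
      ∀ ⦃x y : Λ.Obj⦄ (f : x ⟶ y), (π (Λ.s f) : B) = t f := by
  let ev : BigProduct.{u, v, w} Λ →⋆ₙₐ[ℂ] B := evalHom ⟨B, t, ht⟩
  have hle : Λ.generated (bigFamily.{u, v, w} Λ) ≤ (Λ.generated t).comap ev := by
    refine Λ.generated_le _ _ ?_ (fun x y f => Λ.mem_generated t f)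
    have h0 : IsClosed (Λ.generated t : Set B) := inferInstance
    exact h0.preimage (continuous_hom ev)
  refine ⟨NonUnitalStarAlgHom.codRestrict
    (ev.comp (incl.{u, v, w} Λ)) (Λ.generated t) (fun a => hle (incl_mem Λ a)), fun x y f => rfl, fun π hπ => ?_⟩
  refine hom_ext _ _ fun x y f => Subtype.ext ?_
  rw [hπ f]
  rfl

/-! ### The gauge action -/

/-- The pair with the rescaled family. -/
noncomputable def CKPair.twist (z : Fin k → Circle) (i : CKPair.{u, v, w} Λ) :
    CKPair.{u, v, w} Λ :=
  ⟨i.Alg, Λ.twist z i.fam, i.isCuntzKrieger.twist z⟩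

/-- The homomorphism of the product that permutes the coordinates by rescaling the families. -/
noncomputable def twistHom (z : Fin k → Circle) :
    BigProduct.{u, v, w} Λ →⋆ₙₐ[ℂ] BigProduct.{u, v, w} Λ where
  toFun a := ⟨fun i => (a (i.twist z) : i.Alg), memℓp_infty ⟨‖a‖, by
    rintro _ ⟨i, rfl⟩
    exact lp.norm_apply_le_norm ENNReal.top_ne_zero a (i.twist z)⟩⟩
  map_smul' _ _ := rfl
  map_zero' := rfl
  map_add' _ _ := rfl
  map_mul' _ _ := rfl
  map_star' _ := rfl

theorem twistHom_bigFamily (z : Fin k → Circle) {x y : Λ.Obj} (f : x ⟶ y) :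
    twistHom z (bigFamily.{u, v, w} Λ f) =
      (torusPow z (Λ.deg f) : ℂ) • bigFamily.{u, v, w} Λ f := rfl

theorem twistHom_mem (z : Fin k → Circle) (a : CStar.{u, v, w} Λ) :
    twistHom z (incl Λ a) ∈ Λ.generated (bigFamily.{u, v, w} Λ) := by
  have hle : Λ.generated (bigFamily.{u, v, w} Λ) ≤
      (Λ.generated (bigFamily.{u, v, w} Λ)).comap (twistHom.{u, v, w} (Λ := Λ) z) := by
    refine Λ.generated_le _ _ ?_ (fun x y f => ?_)
    · have h0 : IsClosed (Λ.generated (bigFamily.{u, v, w} Λ) : Set (BigProduct.{u, v, w} Λ)) :=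
        inferInstance
      exact h0.preimage (continuous_hom (twistHom z))
    · rw [NonUnitalStarSubalgebra.mem_comap, twistHom_bigFamily]
      exact SMulMemClass.smul_mem _ (Λ.mem_generated _ f)
  exact hle (incl_mem Λ a)

/-- The endomorphism `γ_z` of `C*(Λ)`. -/
noncomputable def gaugeHom (z : Fin k → Circle) :
    CStar.{u, v, w} Λ →⋆ₙₐ[ℂ] CStar.{u, v, w} Λ :=
  restr Λ ((twistHom z).comp (incl Λ)) (twistHom_mem z)

theorem gaugeHom_s (z : Fin k → Circle) {x y : Λ.Obj} (f : x ⟶ y) :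
    gaugeHom z (Λ.s f : CStar.{u, v, w} Λ) = (torusPow z (Λ.deg f) : ℂ) • Λ.s f := by
  apply incl_injective
  rw [map_smul, incl_s, ← twistHom_bigFamily]
  rfl

theorem gaugeHom_one : gaugeHom (1 : Fin k → Circle) =
    NonUnitalStarAlgHom.id ℂ (CStar.{u, v, w} Λ) :=
  hom_ext _ _ fun x y f => by simp [gaugeHom_s, torusPow_one]

theorem gaugeHom_mul (z z' : Fin k → Circle) : (gaugeHom (z * z') : CStar.{u, v, w} Λ →⋆ₙₐ[ℂ] _) =
    (gaugeHom z).comp (gaugeHom z') :=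
  hom_ext _ _ fun x y f => by
    simp [gaugeHom_s, torusPow_mul, map_smul, smul_smul, mul_comm]

variable (Λ)

/-- The gauge action `γ` of the torus `𝕋^k` on `C*(Λ)` by automorphisms. -/
noncomputable def gauge : (Fin k → Circle) →* (CStar.{u, v, w} Λ ≃⋆ₐ[ℂ] CStar.{u, v, w} Λ) where
  toFun z :=
    { toFun := gaugeHom z
      invFun := gaugeHom z⁻¹
      left_inv := fun a => by
        have := DFunLike.congr_fun (gaugeHom_mul (Λ := Λ) z⁻¹ z) a
        simpa [gaugeHom_one] using this.symm
      right_inv := fun a => by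
        have := DFunLike.congr_fun (gaugeHom_mul (Λ := Λ) z z⁻¹) a
        simpa [gaugeHom_one] using this.symm
      map_mul' := map_mul _
      map_add' := map_add _
      map_star' := map_star _
      map_smul' := map_smul _ }
  map_one' := by
    ext1 a
    exact DFunLike.congr_fun gaugeHom_one a
  map_mul' z z' := by
    ext1 a
    exact DFunLike.congr_fun (gaugeHom_mul z z') a

/-- The defining property of the gauge action: `γ_z(s_f) = z^{d(f)} s_f`. -/
theorem gauge_s (z : Fin k → Circle) {x y : Λ.Obj} (f : x ⟶ y) :
    Λ.gauge z (Λ.s f : CStar.{u, v, w} Λ) = (torusPow z (Λ.deg f) : ℂ) • Λ.s f :=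
  gaugeHom_s z f

end Universal

end KGraph

/-! Averaging over the gauge action sends `s_f s_g^*` to zero unless `d(f) = d(g)`, so the average
of every element lies in the core, the closed span of the `s_f s_g^*` with `d(f) = d(g)`
(`gaugeAverage_mem`).

On the core, `π` is isometric (`norm_map_of_mem_closure`). Relation 4 rewrites any finite
combination of such elements in terms of `t_f t_g^*` with all paths in the sets `Λ^{≤ q}` for one
large `q` (`exists_finset_of_mem_span`). Distinct paths there have orthogonal ranges, so these
products multiply like matrix units and span a finite-dimensional C*-algebra; a homomorphism that
kills no vertex projection is injective on it, hence isometric (`norm_map_of_mem_span`).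

If `π a = 0`, equivariance makes `π` vanish on the average of `a^* a`. This average is therefore
zero, and being the integral of a continuous positive function it forces `a^* a = 0`
(`injective_of_injOn_average`). -/

namespace KGraph

/-! ### Averages over compact groups. -/

section Averaging

open MeasureTheory

/-- A continuous nonnegative function with integral zero vanishes. -/
theorem eq_zero_of_integral_eq_zero {X E : Type*} [TopologicalSpace X] [CompactSpace X]
    [SecondCountableTopology X] [MeasurableSpace X] [BorelSpace X] (μ : Measure X)
    [IsFiniteMeasure μ] [μ.IsOpenPosMeasure] [NormedAddCommGroup E] [NormedSpace ℝ E]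
    [CompleteSpace E] [PartialOrder E] [IsOrderedAddMonoid E] [IsOrderedModule ℝ E]
    [OrderClosedTopology E] {f : X → E} (hf : Continuous f) (hf0 : ∀ x, 0 ≤ f x)
    (h : ∫ x, f x ∂μ = 0) (x : X) : f x = 0 := by
  have hfi : Integrable f μ := hf.integrable_of_hasCompactSupport (.of_compactSpace f)
  rw [← norm_le_zero_iff]
  refine le_of_forall_pos_le_add fun ε hε => ?_
  rw [zero_add]
  let U : Set X := f ⁻¹' Metric.ball (f x) ε
  have hU : IsOpen U := Metric.isOpen_ball.preimage hf
  have hpos : 0 < μ.real U := ENNReal.toReal_pos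
    (hU.measure_pos μ ⟨x, Metric.mem_ball_self hε⟩).ne' (measure_ne_top _ _)
  -- The integrals over `U` and its complement are nonnegative with sum zero.
  have hint : ∫ y in U, f y ∂μ = 0 := by
    have h1 := integral_add_compl hU.measurableSet hfi
    have h2 : 0 ≤ ∫ y in U, f y ∂μ := integral_nonneg hf0
    have h3 : 0 ≤ ∫ y in Uᶜ, f y ∂μ := integral_nonneg hf0
    rw [h] at h1
    exact le_antisymm (by rw [← h1]; exact le_add_of_nonneg_right h3) h2
  -- On `U` the values stay within `ε` of `f x`, so `μ(U) ‖f x‖ ≤ ε μ(U)`, and `μ(U) > 0` cancels.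
  have hsub : ∫ y in U, (f x - f y) ∂μ = μ.real U • f x := by
    rw [integral_sub (integrable_const _) hfi.integrableOn, hint, sub_zero]
    simp
  have hle : ‖∫ y in U, (f x - f y) ∂μ‖ ≤ ε * μ.real U := by
    refine norm_setIntegral_le_of_norm_le_const (measure_lt_top _ _) fun y hy => ?_
    have := Metric.mem_ball.1 hy
    rw [dist_comm, dist_eq_norm] at this
    exact this.le
  rw [hsub, norm_smul, Real.norm_of_nonneg hpos.le, mul_comm] at hle
  exact le_of_mul_le_mul_right hle hpos

variable {G : Type*} [Group G] [TopologicalSpace G] [IsTopologicalGroup G] [CompactSpace G]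
  [SecondCountableTopology G] [MeasurableSpace G] [BorelSpace G] (μ : Measure G)
  [μ.IsHaarMeasure]

omit [IsTopologicalGroup G] in
/-- A homomorphism that respects a continuous compact group action up to kernels and is injective
on the averages is injective. -/
theorem injective_of_injOn_average {A D : Type*} [NonUnitalCStarAlgebra A]
    [NonUnitalCStarAlgebra D] (γ : G →* (A ≃⋆ₐ[ℂ] A)) (hγ : ∀ a, Continuous fun z => γ z a)
    (π : A →⋆ₙₐ[ℂ] D) (hπγ : ∀ z a, π a = 0 → π (γ z a) = 0)
    (hinj : ∀ a, π (∫ z, γ z a ∂μ) = 0 → ∫ z, γ z a ∂μ = 0) : Function.Injective π := by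
  let := CStarAlgebra.spectralOrder A
  have := CStarAlgebra.spectralOrderedRing A
  rw [injective_iff_map_eq_zero]
  intro a ha
  let πL : A →L[ℂ] D := ⟨(π : A →ₗ[ℂ] D), continuous_hom π⟩
  have hint : Integrable (fun z => γ z (star a * a)) μ :=
    (hγ _).integrable_of_hasCompactSupport (.of_compactSpace _)
  have h0 : π (∫ z, γ z (star a * a) ∂μ) = 0 := by
    have := πL.integral_comp_comm hint
    have h1 : ∀ z, πL (γ z (star a * a)) = 0 := fun z => hπγ z _ (by rw [map_mul, ha, mul_zero])
    simp only [h1, integral_zero] at this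
    exact this.symm
  -- The integrand is positive because `γ z` preserves `star a * a` forms; its value at `z = 1` is
  -- `star a * a` itself.
  have h2 := eq_zero_of_integral_eq_zero μ (hγ (star a * a)) (fun z => by
    rw [map_mul, map_star]; exact star_mul_self_nonneg _) (hinj _ h0) 1
  rw [map_one] at h2
  exact CStarRing.star_mul_self_eq_zero_iff a |>.1 h2

omit [CompactSpace G] [SecondCountableTopology G] in
/-- The average of a nontrivial character vanishes. -/
theorem integral_smul_eq_zero {E : Type*} [NormedAddCommGroup E] [NormedSpace ℂ E]
    (χ : G →* ℂ) {w : G} (hw : χ w ≠ 1) (a : E) : ∫ z, χ z • a ∂μ = 0 := by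
  -- Translation by `w` fixes the integral and also multiplies it by `χ w ≠ 1`.
  have h := integral_mul_left_eq_self (μ := μ) (fun z => χ z • a) w
  simp only [map_mul, mul_smul] at h
  rw [integral_smul] at h
  have h2 : (χ w - 1) • ∫ z, χ z • a ∂μ = 0 := by rw [sub_smul, one_smul, h, sub_self]
  exact (smul_eq_zero.1 h2).resolve_left (sub_ne_zero.2 hw)

end Averaging

/-! ### Characters of the torus. -/

theorem circle_exp_one_pow_injective : Function.Injective fun n : ℕ => Circle.exp 1 ^ n := by
  intro m n h
  simp only [← Circle.exp_nsmul, nsmul_eq_mul, mul_one] at h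
  obtain ⟨j, hj⟩ := Circle.exp_eq_exp.1 h
  rcases eq_or_ne j 0 with rfl | hj0
  · simpa using hj
  -- Here `m = n + 2πj` with `j ≠ 0`, which would make `π` rational.
  · refine absurd irrational_pi (not_not.2 ⟨((m : ℚ) - n) / (2 * j), ?_⟩)
    have : (j : ℝ) ≠ 0 := by exact_mod_cast hj0
    push_cast
    field_simp
    linarith

variable {k : ℕ}

/-- The character `z ↦ z^m conj(z^n)` of the torus. -/
noncomputable def torusChar (m n : Fin k → ℕ) : (Fin k → Circle) →* ℂ where
  toFun z := (torusPow z m : ℂ) * star (torusPow z n : ℂ)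
  map_one' := by simp [torusPow_one]
  map_mul' z z' := by
    simp only [torusPow_mul, Circle.coe_mul, star_mul]
    ring

/-- The witness has an element of infinite order in a coordinate where `m` and `n` differ, and 1
elsewhere. -/
theorem exists_torusChar_ne_one {m n : Fin k → ℕ} (h : m ≠ n) : ∃ z, torusChar m n z ≠ 1 := by
  obtain ⟨i, hi⟩ := Function.ne_iff.1 h
  have hz : ∀ l : Fin k → ℕ, torusPow (Pi.mulSingle i (Circle.exp 1)) l = Circle.exp 1 ^ l i := by
    intro l
    rw [torusPow, Finset.prod_eq_single i]
    · simp
    · intro j _ hj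
      simp [Pi.mulSingle_eq_of_ne hj]
    · simp
  refine ⟨Pi.mulSingle i (Circle.exp 1), fun h1 => hi (circle_exp_one_pow_injective ?_)⟩
  have h2 : torusPow (Pi.mulSingle i (Circle.exp 1)) m =
      torusPow (Pi.mulSingle i (Circle.exp 1)) n := by
    apply Circle.ext
    have h3 := circle_conj_mul (torusPow (Pi.mulSingle i (Circle.exp 1)) n)
    calc _ = torusChar m n (Pi.mulSingle i (Circle.exp 1)) *
          (torusPow (Pi.mulSingle i (Circle.exp 1)) n : ℂ) := by
            simp only [torusChar, MonoidHom.coe_mk, OneHom.coe_mk, mul_assoc, h3, mul_one]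
      _ = _ := by rw [h1, one_mul]
  simpa only [hz] using h2

/-! ### Spans as star algebras, and extensions of paths. -/

/-- The star subalgebra with underlying space the span of a set `S`, when this span contains the
products and the adjoints of the members of `S`. -/
def spanStarSubalgebra {A : Type*} [NonUnitalCStarAlgebra A] (S : Set A)
    (hmul : ∀ a ∈ S, ∀ b ∈ S, a * b ∈ Submodule.span ℂ S)
    (hstar : ∀ a ∈ S, star a ∈ Submodule.span ℂ S) : NonUnitalStarSubalgebra ℂ A where
  __ := Submodule.span ℂ S
  mul_mem' {a b} ha hb := by
    refine Submodule.span_induction₂ (p := fun a b _ _ => a * b ∈ Submodule.span ℂ S)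
      (fun a b ha hb => hmul a ha b hb) (fun b _ => by simp) (fun a _ => by simp)
      (fun a b c _ _ _ h h' => by rw [add_mul]; exact add_mem h h')
      (fun a b c _ _ _ h h' => by rw [mul_add]; exact add_mem h h')
      (fun r a b _ _ h => by rw [smul_mul_assoc]; exact Submodule.smul_mem _ r h)
      (fun r a b _ _ h => by rw [mul_smul_comm]; exact Submodule.smul_mem _ r h) ha hb
  star_mem' {a} ha := by
    refine Submodule.span_induction (p := fun a _ => star a ∈ Submodule.span ℂ S)
      (fun a ha => hstar a ha) (by simp)
      (fun a b _ _ h h' => by rw [star_add]; exact add_mem h h')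
      (fun r a _ h => by rw [star_smul]; exact Submodule.smul_mem _ _ h) ha

/-- The paths of `Λ`. -/
abbrev Path (Λ : KGraph.{u, v} k) : Type (max u v) := Σ y : Λ.Obj, Λ.PathTo y

/-- Precomposition of a path with `f`. -/
def extend (Λ : KGraph.{u, v} k) {x y : Λ.Obj} (f : x ⟶ y) (p : Λ.PathTo x) : Λ.PathTo y :=
  ⟨p.1, p.2 ≫ f⟩

/-- The maximality condition only looks at the source, which `p` shares with its extension; the
degree bounds differ by `d(f)` on both sides. Nothing is asked of `f` beyond `d(f) ≤ q`. -/
theorem extend_mem_pathsLE {Λ : KGraph.{u, v} k} {x y : Λ.Obj} (f : x ⟶ y) {q : Fin k → ℕ}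
    (hq : Λ.deg f ≤ q) {p : Λ.PathTo x} (hp : p ∈ Λ.pathsLE (q - Λ.deg f) x) :
    Λ.extend f p ∈ Λ.pathsLE q y := by
  obtain ⟨m, rfl⟩ := exists_add_of_le hq
  rw [add_tsub_cancel_left] at hp
  refine ⟨?_, fun i hi => hp.2 i ?_⟩
  · simpa [extend, Λ.deg_comp] using hp.1
  · simpa [extend, Λ.deg_comp, add_assoc] using hi

/-! ### Matrix units in a Cuntz-Krieger family. -/

namespace IsCuntzKrieger

variable {Λ : KGraph.{u, v} k} [Λ.RowFinite] {A : Type w} [NonUnitalCStarAlgebra A]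
  {t : Λ.Family A} (ht : Λ.IsCuntzKrieger t)

include ht

theorem mul_source {x y : Λ.Obj} (f : x ⟶ y) : t f * t (𝟙 x) = t f := by
  rw [← ht.comp, Category.id_comp]

theorem range_mul {x y : Λ.Obj} (f : x ⟶ y) : t (𝟙 y) * t f = t f := by
  rw [← ht.comp, Category.comp_id]

theorem star_vertex (x : Λ.Obj) : star (t (𝟙 x)) = t (𝟙 x) := (ht.projection x).isSelfAdjoint

theorem source_mul_star {x y : Λ.Obj} (f : x ⟶ y) : t (𝟙 x) * star (t f) = star (t f) := by
  rw [← ht.star_vertex, ← star_mul, ht.mul_source]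

theorem mul_eq_zero {x y x' y' : Λ.Obj} (f : x ⟶ y) (g : x' ⟶ y') (h : x ≠ y') :
    t f * t g = 0 := by
  rw [← ht.mul_source f, ← ht.range_mul g, mul_assoc, ← mul_assoc (t (𝟙 x)),
    ht.orthogonal _ _ h, zero_mul, mul_zero]

theorem mul_star_eq_zero {x y x' y' : Λ.Obj} (f : x ⟶ y) (g : x' ⟶ y') (h : x ≠ x') :
    t f * star (t g) = 0 := by
  rw [← ht.mul_source f, ← ht.source_mul_star g, mul_assoc, ← mul_assoc (t (𝟙 x)),
    ht.orthogonal _ _ h, zero_mul, mul_zero]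

theorem star_mul_eq_zero {x y x' y' : Λ.Obj} (f : x ⟶ y) (g : x' ⟶ y') (h : y ≠ y') :
    star (t f) * t g = 0 := by
  rw [← ht.range_mul f, ← ht.range_mul g, star_mul, ht.star_vertex, mul_assoc,
    ← mul_assoc (t (𝟙 y)), ht.orthogonal _ _ h, zero_mul, mul_zero]

/-- Inserting relation 4 into `t_b^* t_b` gives a sum of positive terms `(t_p^* t_b)^* (t_p^* t_b)`.
The term `p = b` already equals `t_b^* t_b`, so all others vanish. -/
theorem star_mul_of_mem_pathsLE {q : Fin k → ℕ} {y : Λ.Obj} {a b : Λ.PathTo y}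
    (ha : a ∈ Λ.pathsLE q y) (hb : b ∈ Λ.pathsLE q y) (hab : a ≠ b) :
    star (t a.2) * t b.2 = 0 := by
  classical
  let := CStarAlgebra.spectralOrder A
  have := CStarAlgebra.spectralOrderedRing A
  have hsum : ∑ p ∈ (Λ.finite_pathsLE q y).toFinset,
      star (star (t p.2) * t b.2) * (star (t p.2) * t b.2) = star (t b.2) * t b.2 := by
    calc _ = star (t b.2) * (∑ p ∈ (Λ.finite_pathsLE q y).toFinset, t p.2 * star (t p.2)) *
          t b.2 := by
            simp only [Finset.mul_sum, Finset.sum_mul, star_mul, star_star, mul_assoc]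
      _ = _ := by rw [← ht.sum_eq, mul_assoc, ht.range_mul]
  have hb' : b ∈ (Λ.finite_pathsLE q y).toFinset := by simpa using hb
  rw [← Finset.add_sum_erase _ _ hb'] at hsum
  have hbb : star (star (t b.2) * t b.2) * (star (t b.2) * t b.2) = star (t b.2) * t b.2 := by
    rw [ht.star_mul_self, ht.star_vertex, (ht.projection _).isIdempotentElem.eq]
  rw [hbb, add_eq_left, Finset.sum_eq_zero_iff_of_nonneg fun _ _ => star_mul_self_nonneg _] at hsum
  exact CStarRing.star_mul_self_eq_zero_iff _ |>.1 (hsum a (by simp [hab, ha]))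

theorem star_mul_eq_zero_of_ne {q : Fin k → ℕ} {a b : Λ.Path}
    (ha : a.2 ∈ Λ.pathsLE q a.1) (hb : b.2 ∈ Λ.pathsLE q b.1) (hab : a ≠ b) :
    star (t a.2.2) * t b.2.2 = 0 := by
  obtain ⟨y, a⟩ := a
  obtain ⟨y', b⟩ := b
  by_cases h : y = y'
  · subst h
    exact ht.star_mul_of_mem_pathsLE ha hb fun h => hab (congrArg (Sigma.mk y) h)
  · exact ht.star_mul_eq_zero _ _ h

/-- Relation 4 at the source of `f`; it brings paths of different degrees under a common bound. -/
theorem eq_sum_extend {x y : Λ.Obj} (f : x ⟶ y) (m : Fin k → ℕ) :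
    t f = ∑ p ∈ (Λ.finite_pathsLE m x).toFinset, t (Λ.extend f p).2 * star (t p.2) := by
  conv_lhs => rw [← ht.mul_source f, ht.sum_eq x m, Finset.mul_sum]
  exact Finset.sum_congr rfl fun p _ => by rw [← mul_assoc, ← ht.comp]; rfl

theorem mul_star_eq_sum_extend {x y y' : Λ.Obj} (f : x ⟶ y) (g : x ⟶ y') (m : Fin k → ℕ) :
    t f * star (t g) = ∑ p ∈ (Λ.finite_pathsLE m x).toFinset,
      t (Λ.extend f p).2 * star (t (Λ.extend g p).2) := by
  conv_lhs => rw [ht.eq_sum_extend f m, Finset.sum_mul]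
  refine Finset.sum_congr rfl fun p _ => ?_
  rw [mul_assoc, ← star_mul, ← ht.comp]
  rfl

omit ht in
variable (t) in
/-- The elements `t_f t_g^*` with `f` and `g` in a set of paths. -/
def units (S : Set (Λ.Path × Λ.Path)) : Set A := (fun p => t p.1.2.2 * star (t p.2.2.2)) '' S

omit ht [Λ.RowFinite] in
theorem mem_units {S : Set (Λ.Path × Λ.Path)} {p q : Λ.Path} (h : (p, q) ∈ S) :
    t p.2.2 * star (t q.2.2) ∈ Submodule.span ℂ (units t S) :=
  Submodule.subset_span ⟨_, h, rfl⟩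

omit ht [Λ.RowFinite] in
theorem mem_units_univ {x y x' y' : Λ.Obj} (f : x ⟶ y) (g : x' ⟶ y') :
    t f * star (t g) ∈ Submodule.span ℂ (units t Set.univ) :=
  mem_units (p := ⟨y, x, f⟩) (q := ⟨y', x', g⟩) trivial

/-- Extend both paths up to `d(f) ⊔ d(g)`. By orthogonality only pairs with `f a = g b` survive,
each contributing `t_a t_b^*`. -/
theorem star_mul_mem_span {x y x' y' : Λ.Obj} (f : x ⟶ y) (g : x' ⟶ y') :
    star (t f) * t g ∈ Submodule.span ℂ (units t Set.univ) := by
  by_cases h : y = y'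
  · subst h
    set q := Λ.deg f ⊔ Λ.deg g
    rw [ht.eq_sum_extend f (q - Λ.deg f), ht.eq_sum_extend g (q - Λ.deg g), star_sum,
      Finset.sum_mul_sum]
    refine sum_mem fun a ha => sum_mem fun b hb => ?_
    rw [Set.Finite.mem_toFinset] at ha hb
    rw [star_mul, star_star, mul_assoc, ← mul_assoc (star (t (Λ.extend f a).2))]
    by_cases hab : Λ.extend f a = Λ.extend g b
    · rw [← hab, ht.star_mul_self]
      change t a.2 * (t (𝟙 a.1) * _) ∈ _
      rw [← mul_assoc, ht.mul_source]
      exact mem_units_univ _ _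
    · rw [ht.star_mul_of_mem_pathsLE (extend_mem_pathsLE f le_sup_left ha)
        (extend_mem_pathsLE g le_sup_right hb) hab]
      simp
  · rw [ht.star_mul_eq_zero _ _ h]
    exact zero_mem _

/-- With `c = t_p^* t_r`, this closes the span of all `t_f t_g^*` under products. -/
theorem mul_mul_star_mem_span {x y x' y' : Λ.Obj} (f : x ⟶ y) (g : x' ⟶ y') {c : A}
    (hc : c ∈ Submodule.span ℂ (units t Set.univ)) :
    t f * c * star (t g) ∈ Submodule.span ℂ (units t Set.univ) := by
  induction hc using Submodule.span_induction with
  | mem c hc =>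
    obtain ⟨⟨⟨y₁, x₁, a⟩, ⟨y₂, x₂, b⟩⟩, -, rfl⟩ := hc
    change t f * (t a * star (t b)) * star (t g) ∈ _
    rw [mul_assoc, mul_assoc, ← star_mul, ← mul_assoc]
    by_cases h1 : x = y₁
    · by_cases h2 : x' = y₂
      · subst h1 h2
        rw [← ht.comp, ← ht.comp]
        exact mem_units_univ _ _
      · rw [ht.mul_eq_zero _ _ h2]
        simp
    · rw [ht.mul_eq_zero _ _ h1]
      simp
  | zero => simp
  | add a b _ _ ha hb => rw [mul_add, add_mul]; exact add_mem ha hb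
  | smul r a _ ha => rw [mul_smul_comm, smul_mul_assoc]; exact Submodule.smul_mem _ _ ha

/-- A homomorphism that does not annihilate any vertex projection is isometric on the span of the
matrix units given by finitely many members of the sets `Λ^{≤ q}(y)`. -/
theorem norm_map_of_mem_span {D : Type*} [NonUnitalCStarAlgebra D] (φ : A →⋆ₙₐ[ℂ] D)
    (hφ : ∀ x : Λ.Obj, φ (t (𝟙 x)) ≠ 0) (q : Fin k → ℕ) (F : Finset Λ.Path)
    (hF : ∀ p ∈ F, p.2 ∈ Λ.pathsLE q p.1) {a : A}
    (ha : a ∈ Submodule.span ℂ (units t (F ×ˢ F : Finset _))) : ‖φ a‖ = ‖a‖ := by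
  classical
  let E : NonUnitalStarSubalgebra ℂ A := spanStarSubalgebra (units t (F ×ˢ F : Finset _)) (by
    rintro _ ⟨⟨p, p'⟩, hp, rfl⟩ _ ⟨⟨r, r'⟩, hr, rfl⟩
    simp only [Finset.coe_product, Set.mem_prod, Finset.mem_coe] at hp hr
    dsimp only
    rw [mul_assoc, ← mul_assoc (star _)]
    by_cases h : p' = r
    · subst h
      rw [ht.star_mul_self, ← mul_assoc]
      by_cases hs : p.2.1 = p'.2.1
      · rw [← hs, ht.mul_source]
        exact mem_units (by simpa using ⟨hp.1, hr.2⟩)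
      · rw [ht.mul_eq_zero _ _ hs, zero_mul]
        exact zero_mem _
    · rw [ht.star_mul_eq_zero_of_ne (hF _ hp.2) (hF _ hr.1) h]
      simp) (by
    rintro _ ⟨⟨p, p'⟩, hp, rfl⟩
    rw [star_mul, star_star]
    exact mem_units (by simpa [and_comm] using hp))
  have hfin : FiniteDimensional ℂ (Submodule.span ℂ (units t (F ×ˢ F : Finset _))) :=
    FiniteDimensional.span_of_finite ℂ ((Finset.finite_toSet _).image _)
  -- Finite dimension makes `E` closed, hence a C*-algebra, so injectivity of `φ` on it already
  -- gives isometry.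
  have hcl : IsClosed (E : Set A) :=
    (Submodule.span ℂ (units t (F ×ˢ F : Finset _))).closed_of_finiteDimensional
  let : NonUnitalCStarAlgebra E := NonUnitalStarSubalgebra.nonUnitalCStarAlgebra _
  let ψ : E →⋆ₙₐ[ℂ] D := φ.comp (NonUnitalStarSubalgebraClass.subtype E)
  have hψ : Function.Injective ψ := by
    rw [injective_iff_map_eq_zero]
    rintro ⟨b, hb⟩ (hb0 : φ b = 0)
    refine Subtype.ext ?_
    change b = 0
    obtain ⟨c, rfl⟩ := Submodule.mem_span_image_finset_iff_exists_fun' ℂ |>.1 hb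
    refine Finset.sum_eq_zero fun p hp => ?_
    have hp' := Finset.mem_product.1 hp
    -- If the sources differ the unit itself is zero. Otherwise compressing by the two paths of `p`
    -- isolates its coefficient times a vertex projection, which `φ` does not kill.
    by_cases hs : p.1.2.1 = p.2.2.1
    · have key : star (t p.1.2.2) * (∑ r ∈ F ×ˢ F, c r • (t r.1.2.2 * star (t r.2.2.2))) *
          t p.2.2.2 = c p • t (𝟙 p.1.2.1) := by
        rw [Finset.mul_sum, Finset.sum_mul, Finset.sum_eq_single p]
        · rw [mul_smul_comm, smul_mul_assoc, ← mul_assoc, mul_assoc, ht.star_mul_self,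
            ht.star_mul_self, ← hs, (ht.projection _).isIdempotentElem.eq]
        · intro r hr hrp
          have hr' := Finset.mem_product.1 hr
          rw [mul_smul_comm, smul_mul_assoc, ← mul_assoc, mul_assoc]
          by_cases h1 : p.1 = r.1
          · have h2 : r.2 ≠ p.2 := fun h => hrp (Prod.ext h1.symm h)
            rw [ht.star_mul_eq_zero_of_ne (hF _ hr'.2) (hF _ hp'.2) h2, mul_zero, smul_zero]
          · rw [ht.star_mul_eq_zero_of_ne (hF _ hp'.1) (hF _ hr'.1) h1, zero_mul, smul_zero]
        · exact fun h => absurd hp h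
      have h0 := congrArg φ key
      rw [map_mul, map_mul, hb0, mul_zero, zero_mul, map_smul] at h0
      rw [(smul_eq_zero.1 h0.symm).resolve_right (hφ _), zero_smul]
    · rw [ht.mul_star_eq_zero _ _ hs, smul_zero]
  exact NonUnitalStarAlgHom.norm_map ψ hψ ⟨a, ha⟩

omit ht [Λ.RowFinite] in
variable (Λ) in
/-- The pairs of paths of the same degree. -/
def _root_.KGraph.sameDeg : Set (Λ.Path × Λ.Path) := {p | Λ.deg p.1.2.2 = Λ.deg p.2.2.2}

/-- Allowing every `q ≥ q₀` is what lets two summands be written with the same `q`. -/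
theorem exists_finset_of_mem_span {a : A} (ha : a ∈ Submodule.span ℂ (units t Λ.sameDeg)) :
    ∃ q₀ : Fin k → ℕ, ∀ q ≥ q₀, ∃ F : Finset Λ.Path, (∀ p ∈ F, p.2 ∈ Λ.pathsLE q p.1) ∧
      a ∈ Submodule.span ℂ (units t (F ×ˢ F : Finset _)) := by
  classical
  induction ha using Submodule.span_induction with
  | mem a ha =>
    obtain ⟨⟨⟨y, x, f⟩, ⟨y', x', g⟩⟩, hd, rfl⟩ := ha
    change Λ.deg f = Λ.deg g at hd
    refine ⟨Λ.deg f, fun q hq => ?_⟩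
    change ∃ F : Finset Λ.Path, _ ∧ t f * star (t g) ∈ _
    by_cases h : x = x'
    · subst h
      have hfin := Λ.finite_pathsLE (q - Λ.deg f) x
      refine ⟨hfin.toFinset.image (fun p => ⟨y, Λ.extend f p⟩) ∪
        hfin.toFinset.image (fun p => ⟨y', Λ.extend g p⟩), fun p hp => ?_, ?_⟩
      · rw [Finset.mem_union, Finset.mem_image, Finset.mem_image] at hp
        rcases hp with ⟨r, hr, rfl⟩ | ⟨r, hr, rfl⟩
        · exact extend_mem_pathsLE f hq (hfin.mem_toFinset.1 hr)
        -- Equality of degrees is essential here: the same extensions must bring both `f` and `g`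
        -- into `Λ^{≤ q}`.
        · exact extend_mem_pathsLE g (hd ▸ hq) (hd ▸ hfin.mem_toFinset.1 hr)
      · rw [ht.mul_star_eq_sum_extend f g (q - Λ.deg f)]
        refine sum_mem fun p hp => mem_units (p := ⟨y, Λ.extend f p⟩) (q := ⟨y', Λ.extend g p⟩) ?_
        rw [Finset.mem_coe, Finset.mem_product]
        exact ⟨Finset.mem_union_left _ (Finset.mem_image_of_mem _ hp),
          Finset.mem_union_right _ (Finset.mem_image_of_mem _ hp)⟩
    · refine ⟨∅, by simp, ?_⟩
      rw [ht.mul_star_eq_zero _ _ h]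
      exact zero_mem _
  | zero => exact ⟨0, fun q _ => ⟨∅, by simp, zero_mem _⟩⟩
  | add a b _ _ ha hb =>
    obtain ⟨q₁, h₁⟩ := ha
    obtain ⟨q₂, h₂⟩ := hb
    refine ⟨q₁ ⊔ q₂, fun q hq => ?_⟩
    obtain ⟨F₁, hF₁, ha⟩ := h₁ q (le_sup_left.trans hq)
    obtain ⟨F₂, hF₂, hb⟩ := h₂ q (le_sup_right.trans hq)
    refine ⟨F₁ ∪ F₂, fun p hp => (Finset.mem_union.1 hp).elim (hF₁ p) (hF₂ p), add_mem
      (Submodule.span_mono (Set.image_mono ?_) ha) (Submodule.span_mono (Set.image_mono ?_) hb)⟩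
    · exact Finset.coe_subset.2
        (Finset.product_subset_product Finset.subset_union_left Finset.subset_union_left)
    · exact Finset.coe_subset.2
        (Finset.product_subset_product Finset.subset_union_right Finset.subset_union_right)
  | smul r a _ ha =>
    obtain ⟨q₀, h⟩ := ha
    refine ⟨q₀, fun q hq => ?_⟩
    obtain ⟨F, hF, ha⟩ := h q hq
    exact ⟨F, hF, Submodule.smul_mem _ r ha⟩

/-- A homomorphism that does not annihilate any vertex projection is isometric on the closed span
of the elements `t_f t_g^*` with `d(f) = d(g)`. -/
theorem norm_map_of_mem_closure {D : Type*} [NonUnitalCStarAlgebra D] (φ : A →⋆ₙₐ[ℂ] D)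
    (hφ : ∀ x : Λ.Obj, φ (t (𝟙 x)) ≠ 0) {a : A}
    (ha : a ∈ (Submodule.span ℂ (units t Λ.sameDeg)).topologicalClosure) : ‖φ a‖ = ‖a‖ := by
  have hcl : IsClosed {a : A | ‖φ a‖ = ‖a‖} :=
    isClosed_eq (continuous_hom φ).norm continuous_norm
  refine closure_minimal (fun b hb => ?_) hcl ha
  obtain ⟨q, h⟩ := ht.exists_finset_of_mem_span hb
  obtain ⟨F, hF, hbF⟩ := h q le_rfl
  exact ht.norm_map_of_mem_span φ hφ q F hF hbF

end IsCuntzKrieger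

/-! ### The gauge action and the core of the universal algebra. -/

section Universal

variable {Λ : KGraph.{u, v} k} [Λ.RowFinite]

open IsCuntzKrieger MeasureTheory

/-- A closed star subalgebra of `C*(Λ)` that contains the generators is everything. -/
theorem mem_of_forall_s_mem (S : NonUnitalStarSubalgebra ℂ (CStar.{u, v, w} Λ))
    (hS : IsClosed (S : Set (CStar.{u, v, w} Λ))) (h : ∀ ⦃x y : Λ.Obj⦄ (f : x ⟶ y), Λ.s f ∈ S)
    (a : CStar.{u, v, w} Λ) : a ∈ S := by
  have h0 : IsClosed (Λ.generated (bigFamily.{u, v, w} Λ) : Set (BigProduct.{u, v, w} Λ)) :=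
    inferInstance
  have hcl : IsClosed ((S.map (incl Λ) : NonUnitalStarSubalgebra ℂ (BigProduct.{u, v, w} Λ)) :
      Set (BigProduct.{u, v, w} Λ)) := h0.isClosedEmbedding_subtypeVal.isClosedMap _ hS
  obtain ⟨b, hb, hba⟩ := Λ.generated_le _ _ hcl (fun x y f => ⟨Λ.s f, h f, rfl⟩) (incl_mem Λ a)
  exact incl_injective Λ hba ▸ hb

theorem mem_closure_span_units (a : CStar.{u, v, w} Λ) :
    a ∈ (Submodule.span ℂ (units Λ.s Set.univ)).topologicalClosure := by
  have hs := isCuntzKrieger_s.{u, v, w} Λ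
  let S : NonUnitalStarSubalgebra ℂ (CStar.{u, v, w} Λ) :=
    spanStarSubalgebra (units Λ.s Set.univ) (by
      rintro _ ⟨⟨p, p'⟩, -, rfl⟩ _ ⟨⟨r, r'⟩, -, rfl⟩
      have := hs.mul_mul_star_mem_span p.2.2 r'.2.2 (hs.star_mul_mem_span p'.2.2 r.2.2)
      simpa only [mul_assoc] using this) (by
      rintro _ ⟨⟨p, p'⟩, -, rfl⟩
      rw [star_mul, star_star]
      exact mem_units_univ _ _)
  refine mem_of_forall_s_mem S.topologicalClosure
    (NonUnitalStarSubalgebra.isClosed_topologicalClosure _) (fun x y f => ?_) a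
  refine NonUnitalStarSubalgebra.le_topologicalClosure _ ?_
  -- A generator is itself a unit: `s_f = s_f s_x^*` for the source `x`.
  have := mem_units_univ (t := (Λ.s : Λ.Family (CStar.{u, v, w} Λ))) f (𝟙 x)
  rwa [hs.star_vertex, hs.mul_source] at this

theorem continuous_torusPow (n : Fin k → ℕ) : Continuous fun z : Fin k → Circle => torusPow z n :=
  continuous_finsetProd _ fun i _ => (continuous_apply i).pow _

/-- The gauge action is strongly continuous. -/
theorem continuous_gauge (a : CStar.{u, v, w} Λ) : Continuous fun z => Λ.gauge z a := by
  let S : NonUnitalStarSubalgebra ℂ (CStar.{u, v, w} Λ) :=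
    { carrier := {a | Continuous fun z => Λ.gauge z a}
      add_mem' := fun ha hb => (Continuous.add ha hb).congr fun z => (map_add _ _ _).symm
      zero_mem' := continuous_const.congr fun z => (map_zero _).symm
      mul_mem' := fun ha hb => (Continuous.mul ha hb).congr fun z => (map_mul _ _ _).symm
      smul_mem' := fun c a ha => (Continuous.const_smul ha c).congr fun z => (map_smul (Λ.gauge z) c _).symm
      star_mem' := fun ha => (Continuous.star ha).congr fun z => (map_star _ _).symm }
  refine mem_of_forall_s_mem S ?_ (fun x y f => ?_) a
  -- Each `γ_z` is contractive, so approximating `b` in norm approximates its orbit map uniformly in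
  -- `z`.
  · refine isClosed_of_closure_subset fun b hb => ?_
    refine continuous_of_uniform_approx_of_continuous fun U hU => ?_
    obtain ⟨ε, hε, hU⟩ := Metric.mem_uniformity_dist.1 hU
    obtain ⟨c, hc, hbc⟩ := Metric.mem_closure_iff.1 hb ε hε
    refine ⟨fun z => Λ.gauge z c, hc, fun z => hU ?_⟩
    rw [dist_eq_norm, ← map_sub]
    rw [dist_eq_norm] at hbc
    exact (NonUnitalStarAlgHom.norm_apply_le (Λ.gauge z) _).trans_lt hbc
  · change Continuous fun z => Λ.gauge z (Λ.s f)
    simp only [gauge_s]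
    exact (continuous_subtype_val.comp (continuous_torusPow _)).smul continuous_const

variable [MeasurableSpace (Fin k → Circle)] [BorelSpace (Fin k → Circle)]
  (μ : Measure (Fin k → Circle)) [μ.IsHaarMeasure]

theorem integrable_gauge (a : CStar.{u, v, w} Λ) : Integrable (fun z => Λ.gauge z a) μ :=
  (continuous_gauge a).integrable_of_hasCompactSupport (.of_compactSpace _)

variable (Λ) in
/-- The average over the gauge action. -/
noncomputable def gaugeAverage : CStar.{u, v, w} Λ →L[ℂ] CStar.{u, v, w} Λ :=
  LinearMap.mkContinuous
    { toFun := fun a => ∫ z, Λ.gauge z a ∂μ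
      map_add' := fun a b => by
        simp only [map_add]
        exact integral_add (integrable_gauge μ a) (integrable_gauge μ b)
      map_smul' := fun c a => by
        simp only [map_smul]
        exact integral_smul c _ }
    -- The measure is not normalised, so its total mass bounds the operator.
    (μ.real Set.univ) fun a => by
      rw [mul_comm]
      exact norm_integral_le_of_norm_le_const
        (.of_forall fun z => NonUnitalStarAlgHom.norm_apply_le (Λ.gauge z) a)

omit [MeasurableSpace (Fin k → Circle)] [BorelSpace (Fin k → Circle)] in
theorem gauge_unit (z : Fin k → Circle) {x y x' y' : Λ.Obj} (f : x ⟶ y) (g : x' ⟶ y') :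
    Λ.gauge z (Λ.s f * star (Λ.s g) : CStar.{u, v, w} Λ) =
      torusChar (Λ.deg f) (Λ.deg g) z • (Λ.s f * star (Λ.s g)) := by
  rw [map_mul, map_star, gauge_s, gauge_s, star_smul, smul_mul_smul_comm]
  rfl

/-- The average over the gauge action takes values in the closed span of the elements
`s_f s_g^*` with `d(f) = d(g)`. -/
theorem gaugeAverage_mem (a : CStar.{u, v, w} Λ) :
    gaugeAverage Λ μ a ∈ (Submodule.span ℂ (units Λ.s Λ.sameDeg)).topologicalClosure := by
  let C := (Submodule.span ℂ (units (Λ.s : Λ.Family (CStar.{u, v, w} Λ)) Λ.sameDeg)).topologicalClosure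
  have hCc : IsClosed (C : Set (CStar.{u, v, w} Λ)) := Submodule.isClosed_topologicalClosure _
  have hle : (Submodule.span ℂ (units Λ.s Set.univ)).topologicalClosure ≤
      C.comap (gaugeAverage Λ μ : CStar.{u, v, w} Λ →ₗ[ℂ] CStar.{u, v, w} Λ) := by
    refine Submodule.topologicalClosure_minimal _ (Submodule.span_le.2 ?_)
      (hCc.preimage (gaugeAverage Λ μ).continuous)
    rintro _ ⟨⟨⟨y, x, f⟩, ⟨y', x', g⟩⟩, -, rfl⟩
    change ∫ z, Λ.gauge z (Λ.s f * star (Λ.s g)) ∂μ ∈ C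
    simp only [gauge_unit]
    by_cases h : Λ.deg f = Λ.deg g
    -- For equal degrees the unit is gauge-invariant and is only scaled by the total mass.
    · have h1 : ∀ z, torusChar (Λ.deg f) (Λ.deg g) z = 1 := fun z => by
        rw [h, torusChar, MonoidHom.coe_mk, OneHom.coe_mk, mul_comm]
        exact circle_conj_mul _
      simp only [h1, one_smul, integral_const]
      rw [← Complex.coe_smul]
      refine Submodule.smul_mem _ _ (Submodule.le_topologicalClosure _ ?_)
      exact mem_units (p := ⟨y, x, f⟩) (q := ⟨y', x', g⟩) h
    · obtain ⟨w, hw⟩ := exists_torusChar_ne_one h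
      rw [integral_smul_eq_zero μ _ hw]
      exact zero_mem _
  exact hle (mem_closure_span_units a)

end Universal

end KGraph

theorem theorem4p1 {k : ℕ} (Λ : KGraph.{u, v} k) [Λ.RowFinite] (hΛ : Λ.LocallyConvex)
    {B : Type w} [NonUnitalCStarAlgebra B] (t : Λ.Family B) (ht : Λ.IsCuntzKrieger t)
    (π : KGraph.CStar.{u, v, w} Λ →⋆ₙₐ[ℂ] Λ.generated t)
    (hπ : ∀ (x y : Λ.Obj) (f : x ⟶ y), (π (Λ.s f) : B) = t f)
    (hne : ∀ x : Λ.Obj, t (𝟙 x) ≠ 0)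
    (β : (Fin k → Circle) →* (Λ.generated t ≃⋆ₐ[ℂ] Λ.generated t))
    (hβ : ∀ b : Λ.generated t, Continuous fun z : Fin k → Circle => β z b)
    (hβπ : ∀ (z : Fin k → Circle) (a : KGraph.CStar.{u, v, w} Λ), β z (π a) = π (Λ.gauge z a)) :
    Function.Injective π := by
  let : MeasurableSpace (Fin k → Circle) := borel _
  have : BorelSpace (Fin k → Circle) := ⟨rfl⟩
  refine KGraph.injective_of_injOn_average
    (MeasureTheory.Measure.haarMeasure (⊤ : TopologicalSpace.PositiveCompacts (Fin k → Circle)))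
    Λ.gauge KGraph.continuous_gauge π (fun z a ha => by rw [← hβπ, ha, map_zero]) fun a ha => ?_
  have hmem := KGraph.gaugeAverage_mem (Λ := Λ)
    (MeasureTheory.Measure.haarMeasure (⊤ : TopologicalSpace.PositiveCompacts (Fin k → Circle))) a
  -- The nonvanishing of each `t_x` is exactly what makes `π` isometric on the core.
  have hnorm := (KGraph.isCuntzKrieger_s Λ).norm_map_of_mem_closure π (fun x h0 => hne x (by
    rw [← hπ, h0]; rfl)) hmem
  rw [← norm_eq_zero, ← norm_eq_zero.2 ha]
  exact hnorm.symm
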